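/- A (simple) $t$-$(v,k,\lambda)$ design is a set $X$ of $v$ points together with a set of $k$-subsets of $X$, called blocks, such that every $t$-subset of $X$ is contained in exactly $\lambda$ blocks. It is self-orthogonal if $|B\cap B'|\equiv k \pmod 2$ for any two distinct blocks $B,B'$. The complementary design $\overline{\mathcal D}$ of $\mathcal D$ is obtained by replacing each block by its complement in $X$, and $C(\mathcal D)\subseteq \mathbb F_2^X$ is the binary code generated by the rows of the block-point incidence matrix of $\mathcal D$. For $m\ge 1$, let $W_m(y)=\sum_j A_j y^j$ be the weight enumerator of an extremal doubly even self-dual code of length $24m$, i.e. (whether or not such a code exists) the unique polynomial of the form $$W_m(y)=\sum_{i=0}^{m} a_i\,(1+14y^4+y^8)^{3m-3i}\bigl(y^4(1-y^4)^4\bigr)^i,\qquad a_i\in\mathbb Z,$$ with $A_0=1$ and $A_4=A_8=\dots=A_{4m}=0$. Put $\lambda_{24m,4k}=A_{4k}\binom{4k}{5}/\binom{24m}{5}$. When an extremal doubly even self-dual code of length $24m$ exists, this is the parameter $\lambda$ of the $5$-design formed by the supports of its codewords of weight $4k$. A design $\mathcal D_{24m,4k}$ is any self-orthogonal $5$-$(24m,4k,\lambda_{24m,4k})$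 design. **Proposition 3.4.** Let $m\in\{1,\dots,6\}$ and $k\in\{m+1,\dots,3m-1\}$. The designs $\mathcal D_{24m,24m-4k}$ are exactly the complementary designs of the designs $\mathcal D_{24m,4k}$: a simple block design $\mathcal D$ is a self-orthogonal $5$-$(24m,4k,\lambda_{24m,4k})$ design if and only if $\overline{\mathcal D}$ is a self-orthogonal $5$-$(24m,24m-4k,\lambda_{24m,24m-4k})$ design. Moreover, for every such $\mathcal D=\mathcal D_{24m,4k}$ with complementary design $\mathcal D_{24m,24m-4k}=\overline{\mathcal D}$, $$C(\mathcal D_{24m,4k})=C(\mathcal D_{24m,24m-4k}).$$ -/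

import Mathlib

/-! ### Block designs and their binary codes

A simple block design on a point set `X` is given by its finite set of blocks
`D : Finset (Finset X)`; repeated blocks are thereby excluded. -/

/-- `D` is a simple `t`-`(v, k, l)` design with point set `X`: there are `v` points, every block has
`k` points, and every `t`-subset of the points is contained in exactly `l` blocks. -/
structure IsDesign {X : Type*} [Fintype X] [DecidableEq X] (t v k l : ℕ)
    (D : Finset (Finset X)) : Prop where
  card_points : Fintype.card X = v
  card_block : ∀ B ∈ D, B.card = k
  balanced : ∀ T : Finset X, T.card = t → (D.filter (fun B => T ⊆ B)).card = l

/-- A design with block size `k` is self-orthogonal if the block intersection numbers (of two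
distinct blocks) have the same parity as `k`. -/
def IsSelfOrthogonalDesign {X : Type*} [DecidableEq X] (k : ℕ) (D : Finset (Finset X)) : Prop :=
  ∀ B ∈ D, ∀ B' ∈ D, B ≠ B' → (B ∩ B').card ≡ k [MOD 2]

/-- The complementary design: every block is replaced by its complement. -/
def complementDesign {X : Type*} [Fintype X] [DecidableEq X] (D : Finset (Finset X)) :
    Finset (Finset X) :=
  D.image (fun B => Bᶜ)

/-- The block-point incidence matrix, with entries in the field with two elements. -/
def incidenceMatrix {X : Type*} [DecidableEq X] (D : Finset (Finset X)) :
    Matrix {B // B ∈ D} X (ZMod 2) :=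
  Matrix.of (fun B x => if x ∈ B.1 then 1 else 0)

/-- The binary code `C(D)` generated by the rows of the incidence matrix of `D`. -/
def designCode {X : Type*} [DecidableEq X] (D : Finset (Finset X)) :
    Submodule (ZMod 2) (X → ZMod 2) :=
  Submodule.span (ZMod 2) (Set.range (incidenceMatrix D).row)

/-! ### The weight enumerator of an extremal doubly even self-dual code of length `24 m`

By Gleason's theorem the weight enumerator of a doubly even self-dual code of length `24 m` is
`∑ i ∈ {0, …, m}, a i • (1 + 14 y^4 + y^8)^(3 m - 3 i) * (y^4 (1 - y^4)^4)^i` with integers `a i`.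
If the code is extremal (minimum weight `4 m + 4`), the coefficients of `y^0, y^4, …, y^(4 m)` are
`1, 0, …, 0`; as the `i`-th summand starts with `y^(4 i)`, this determines the `a i`, one after
another. All these polynomials are polynomials in `z = y^4`; below they are represented by the
lists of their coefficients in `z`, constant term first. -/

/-- Sum of two polynomials given by their coefficient lists. -/
def polyAdd : List ℤ → List ℤ → List ℤ
  | [], q => q
  | p, [] => p
  | a :: p, b :: q => (a + b) :: polyAdd p q

/-- Scalar multiple of a polynomial given by its coefficient list. -/
def polySmul (c : ℤ) (p : List ℤ) : List ℤ := p.map (fun a => c * a)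

/-- Product of two polynomials given by their coefficient lists. -/
def polyMul : List ℤ → List ℤ → List ℤ
  | [], _ => []
  | a :: p, q => polyAdd (polySmul a q) (0 :: polyMul p q)

/-- Power of a polynomial given by its coefficient list. -/
def polyPow (p : List ℤ) : ℕ → List ℤ
  | 0 => [1]
  | n + 1 => polyMul p (polyPow p n)

/-- The polynomial `(1 + 14 z + z^2)^(3 (m - i)) * (z (1 - z)^4)^i`, for `i ≤ m`. -/
def gleasonTerm (m i : ℕ) : List ℤ :=
  polyMul (polyPow [1, 14, 1] (3 * (m - i))) (polyPow [0, 1, -4, 6, -4, 1] i)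

/-- The combination of the Gleason terms of index at most `i` with coefficients
`1, 0, …, 0` at `z^0, z^1, …, z^i`. -/
def gleasonReduce (m : ℕ) : ℕ → List ℤ
  | 0 => gleasonTerm m 0
  | i + 1 =>
    polyAdd (gleasonReduce m i)
      (polySmul (-((gleasonReduce m i).getD (i + 1) 0)) (gleasonTerm m (i + 1)))

/-- The weight enumerator, as a polynomial in `z = y^4`, of an extremal doubly even self-dual code
of length `24 m`. -/
def extremalEnumerator (m : ℕ) : List ℤ := gleasonReduce m m

/-- The number of codewords of weight `4 k` in an extremal doubly even self-dual code of length
`24 m`. -/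
def extremalCount (m k : ℕ) : ℕ := ((extremalEnumerator m).getD k 0).toNat

/-- The number `λ_{24m,4k}`: the codewords of weight `4 k` of an extremal doubly even self-dual
code of length `24 m` are the blocks of a `5`-`(24 m, 4 k, λ)` design, and the number of blocks of
such a design is `λ * (24 m).choose 5 / (4 k).choose 5`. The division is exact
(see `extremal_sanity`). -/
def designLambda (m k : ℕ) : ℕ :=
  extremalCount m k * (4 * k).choose 5 / (24 * m).choose 5

/-- `D` is a design `D_{24m,4k}`: a self-orthogonal `5`-`(24 m, 4 k, λ_{24m,4k})` design. -/
def IsExtremalTypeDesign {X : Type*} [Fintype X] [DecidableEq X] (m k : ℕ)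
    (D : Finset (Finset X)) : Prop :=
  IsDesign 5 (24 * m) (4 * k) (designLambda m k) D ∧ IsSelfOrthogonalDesign (4 * k) D

set_option maxRecDepth 100000 in
/-- For `m ∈ {1, …, 6}`: the polynomial above is extremal, has degree `6 m` in `z`, and the
division that defines `λ_{24m,4k}` is exact, with positive result, for
`k ∈ {m + 1, …, 5 m - 1}`. -/
theorem extremal_sanity : ∀ m ∈ List.range' 1 6,
    (extremalEnumerator m).take (m + 1) = 1 :: List.replicate m 0 ∧
    (extremalEnumerator m).length = 6 * m + 1 ∧
    ∀ k ∈ List.range' (m + 1) (4 * m - 1),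
      0 < (extremalEnumerator m).getD k 0 ∧ 0 < designLambda m k ∧
      designLambda m k * (24 * m).choose 5 = extremalCount m k * (4 * k).choose 5 := by
  decide +kernel

set_option maxRecDepth 100000 in
/-- The values of `λ_{24m,4k}` for `m ∈ {1, …, 6}` and `k ∈ {m + 1, …, 3 m}`. -/
theorem designLambda_values :
    (List.range' 1 6).map (fun m => (List.range' (m + 1) (2 * m)).map (designLambda m)) =
    [[1, 48],
     [8, 1365, 36176, 190680],
     [78, 20064, 1406405, 30888000, 238957796, 693996160],
     [816, 257180, 29975400, 1390528685, 28080500448, 261513764460, 1167789832440,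
      2561776811880],
     [8855, 3146400, 502593700, 37237713920, 1372275835848, 26386953577600, 274320081834480,
      1582247888524800, 5156299310025435, 9606041207517888],
     [98280, 37756202, 7479335776, 765322879032, 42785304274536, 1359454757387265,
      25319185698144240, 283096123959568608, 1935608752827917264, 8205989047403924124,
      21788133027489299328, 36470135955078919440]] := by
  decide +kernel

/-! ### Counting blocks of a design through, or disjoint from, a given set -/

section Counting

variable {X : Type*} [DecidableEq X]

/-! By inclusion-exclusion, the number of blocks missing a `t`-set is constant, so complements form
a design; averaging gives its parameter, matched numerically by `designLambda_complement`. A row of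
the complement is the all-one vector minus a row of `D`, so the codes agree once both contain the
all-one vector. By duality this means that every set `S` meeting all blocks evenly is even. For
this, sum p(x) = x(x-2)(x-4)(x-6)(x-8) over x = |S ∩ B|. Each term is divisible by 3840 = 2^8 * 15.
In the binomial basis only the first coefficient of p, 105, is odd, and the design equations turn
the sum into a combination of |S|-binomials times λ_1, ..., λ_5. If 2^a, a < 8, exactly divides λ_1
and divides the other λ_i, an odd |S| is impossible modulo 2^(a+1). -/

theorem card_between {T B : Finset X} (h : T ⊆ B) {t : ℕ} (ht : T.card ≤ t) :
    ((B.powersetCard t).filter (fun U => T ⊆ U)).card =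
      (B.card - T.card).choose (t - T.card) := by
  rw [← Finset.card_sdiff_of_subset h, ← Finset.card_powersetCard]
  refine Finset.card_bij' (fun U _ => U \ T) (fun V _ => V ∪ T) ?_ ?_ ?_ ?_
  · intro U hU
    rw [Finset.mem_filter, Finset.mem_powersetCard] at hU
    rw [Finset.mem_powersetCard]
    exact ⟨Finset.sdiff_subset_sdiff hU.1.1 le_rfl, by
      rw [Finset.card_sdiff_of_subset hU.2, hU.1.2]⟩
  · intro V hV
    rw [Finset.mem_powersetCard] at hV
    rw [Finset.mem_filter, Finset.mem_powersetCard]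
    have hd : Disjoint V T := Finset.disjoint_of_subset_left hV.1 Finset.sdiff_disjoint
    refine ⟨⟨Finset.union_subset (hV.1.trans Finset.sdiff_subset) h, ?_⟩,
      Finset.subset_union_right⟩
    rw [Finset.card_union_of_disjoint hd, hV.2]
    omega
  · intro U hU
    rw [Finset.mem_filter] at hU
    exact Finset.sdiff_union_of_subset hU.2
  · intro V hV
    rw [Finset.mem_powersetCard] at hV
    have hd : Disjoint V T := Finset.disjoint_of_subset_left hV.1 Finset.sdiff_disjoint
    exact Finset.union_sdiff_cancel_right hd

/-- Double count of pairs (T, B) with T an `i`-subset of S ∩ B. -/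
theorem sum_choose_card_inter (D : Finset (Finset X)) (S : Finset X) (i : ℕ) :
    ∑ B ∈ D, (S ∩ B).card.choose i =
      ∑ T ∈ S.powersetCard i, (D.filter (fun B => T ⊆ B)).card := by
  simp_rw [Finset.card_filter]
  rw [Finset.sum_comm]
  refine Finset.sum_congr rfl fun B _ => ?_
  rw [← Finset.card_filter, ← Finset.card_powersetCard]
  congr 1
  ext T
  simp only [Finset.mem_powersetCard, Finset.mem_filter, Finset.subset_inter_iff]
  tauto

/-- Inclusion-exclusion: the alternating sum over subsets of T ∩ B vanishes unless T ∩ B is empty.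
-/
theorem card_filter_disjoint_eq (D : Finset (Finset X)) (T : Finset X) :
    ((D.filter (fun B => Disjoint T B)).card : ℤ) =
      ∑ S ∈ T.powerset, (-1) ^ S.card * ((D.filter (fun B => S ⊆ B)).card : ℤ) := by
  simp_rw [Finset.card_filter, Nat.cast_sum, Finset.mul_sum]
  rw [Finset.sum_comm]
  refine Finset.sum_congr rfl fun B _ => ?_
  have h := Finset.sum_powerset_neg_one_pow_card (x := T ∩ B)
  simp only [Finset.disjoint_iff_inter_eq_empty]
  push_cast
  rw [← h]
  simp_rw [mul_ite, mul_one, mul_zero]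
  rw [← Finset.sum_filter]
  refine Finset.sum_congr ?_ fun _ _ => rfl
  ext S
  simp only [Finset.mem_powerset, Finset.mem_filter, Finset.subset_inter_iff]

variable [Fintype X] {t v K l : ℕ} {D : Finset (Finset X)}

/-- Double count of pairs (B, U) with T ⊆ U ⊆ B and |U| = t. -/
theorem IsDesign.card_filter_subset_mul (h : IsDesign t v K l D) {T : Finset X}
    (hT : T.card ≤ t) :
    (D.filter (fun B => T ⊆ B)).card * (K - T.card).choose (t - T.card) =
      l * (v - T.card).choose (t - T.card) := by
  have key : ∑ B ∈ D.filter (fun B => T ⊆ B),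
        ((B.powersetCard t).filter (fun U => T ⊆ U)).card =
      ∑ U ∈ (Finset.univ.powersetCard t).filter (fun U => T ⊆ U),
        (D.filter (fun B => U ⊆ B)).card := by
    simp_rw [Finset.card_eq_sum_ones]
    refine Finset.sum_comm' fun B U => ?_
    simp only [Finset.mem_filter, Finset.mem_powersetCard, Finset.subset_univ, true_and]
    constructor
    · rintro ⟨⟨hB, hTB⟩, ⟨hUB, hU⟩, hTU⟩
      exact ⟨⟨hB, hUB⟩, hU, hTU⟩
    · rintro ⟨⟨hB, hUB⟩, hU, hTU⟩
      exact ⟨⟨hB, hTU.trans hUB⟩, ⟨hUB, hU⟩, hTU⟩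
  rw [Finset.sum_congr rfl (g := fun _ => (K - T.card).choose (t - T.card)),
    Finset.sum_const, Finset.sum_congr rfl (g := fun _ => l), Finset.sum_const,
    card_between (Finset.subset_univ T) hT, Finset.card_univ, h.card_points] at key
  · rw [smul_eq_mul, smul_eq_mul] at key
    rw [key, mul_comm]
  · intro U hU
    rw [Finset.mem_filter, Finset.mem_powersetCard] at hU
    exact h.balanced U hU.1.2
  · intro B hB
    rw [Finset.mem_filter] at hB
    rw [card_between hB.2 hT, h.card_block B hB.1]

/-- The number of blocks of a `t`-`(v, K, l)` design that contain a given set of `i ≤ t` points. -/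
def replication (t v K l i : ℕ) : ℕ := l * (v - i).choose (t - i) / (K - i).choose (t - i)

theorem IsDesign.card_filter_subset (h : IsDesign t v K l D) (hK : t ≤ K) {T : Finset X}
    (hT : T.card ≤ t) :
    (D.filter (fun B => T ⊆ B)).card = replication t v K l T.card :=
  (Nat.div_eq_of_eq_mul_left (Nat.choose_pos (by omega))
    (h.card_filter_subset_mul hT).symm).symm

theorem IsDesign.sum_choose (h : IsDesign t v K l D) (hK : t ≤ K) (S : Finset X) {i : ℕ}
    (hi : i ≤ t) :
    ∑ B ∈ D, (S ∩ B).card.choose i = S.card.choose i * replication t v K l i := by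
  rw [sum_choose_card_inter, Finset.sum_congr rfl (g := fun _ => replication t v K l i),
    Finset.sum_const, Finset.card_powersetCard, smul_eq_mul]
  intro T hT
  rw [Finset.mem_powersetCard] at hT
  rw [h.card_filter_subset hK (hT.2.trans_le hi), hT.2]

theorem IsDesign.exists_card_filter_disjoint (h : IsDesign t v K l D) (hK : t ≤ K) :
    ∃ c : ℤ, ∀ T : Finset X, T.card = t → ((D.filter (fun B => Disjoint T B)).card : ℤ) = c := by
  refine ⟨∑ j ∈ Finset.range (t + 1), t.choose j • ((-1) ^ j * (replication t v K l j : ℤ)),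
    fun T hT => ?_⟩
  rw [card_filter_disjoint_eq, ← hT,
    ← Finset.sum_powerset_apply_card (fun j => (-1) ^ j * (replication T.card v K l j : ℤ)) (x := T)]
  refine Finset.sum_congr rfl fun S hS => ?_
  rw [h.card_filter_subset hK (hT ▸ Finset.card_le_card (Finset.mem_powerset.1 hS)), hT]

/-! ### Complementary designs -/

theorem complementDesign_complementDesign (D : Finset (Finset X)) :
    complementDesign (complementDesign D) = D := by
  simp [complementDesign]

theorem mem_complementDesign {D : Finset (Finset X)} {B : Finset X} :
    B ∈ complementDesign D ↔ Bᶜ ∈ D := by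
  simp only [complementDesign, Finset.mem_image]
  exact ⟨fun ⟨A, hA, e⟩ => by rwa [← e, compl_compl], fun hB => ⟨_, hB, compl_compl B⟩⟩

theorem card_filter_complementDesign (D : Finset (Finset X)) (T : Finset X) :
    ((complementDesign D).filter (fun B => T ⊆ B)).card =
      (D.filter (fun B => Disjoint T B)).card := by
  refine Finset.card_bij' (fun B _ => Bᶜ) (fun B _ => Bᶜ) ?_ ?_ ?_ ?_
  · intro B hB
    rw [Finset.mem_filter, mem_complementDesign] at hB
    rw [Finset.mem_filter]
    exact ⟨hB.1, disjoint_compl_right_iff.2 hB.2⟩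
  · intro B hB
    rw [Finset.mem_filter] at hB
    rw [Finset.mem_filter, mem_complementDesign, compl_compl]
    exact ⟨hB.1, Finset.subset_compl_iff_disjoint_right.2 hB.2⟩
  · intro B _
    exact compl_compl B
  · intro B _
    exact compl_compl B

theorem IsDesign.complementDesign {l' : ℕ} (h : IsDesign t v K l D) (hK : t ≤ K) (hv : K ≤ v)
    (hl : l' * K.choose t = l * (v - K).choose t) :
    IsDesign t v (v - K) l' (complementDesign D) := by
  refine ⟨h.card_points, fun B hB => ?_, fun T hT => ?_⟩
  · have := h.card_block _ (mem_complementDesign.1 hB)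
    rw [Finset.card_compl, h.card_points] at this
    have hB' : B.card ≤ v := h.card_points ▸ Finset.card_le_univ B
    omega
  · rw [card_filter_complementDesign]
    obtain ⟨c, hc⟩ := h.exists_card_filter_disjoint hK
    -- Averaging over all `t`-sets finds the constant without evaluating the alternating sum.
    have hsum : ∑ U ∈ (Finset.univ : Finset X).powersetCard t,
        (D.filter (fun B => Disjoint U B)).card = D.card * (v - K).choose t := by
      simp_rw [Finset.card_filter]
      rw [Finset.sum_comm, ← smul_eq_mul, ← Finset.sum_const]
      refine Finset.sum_congr rfl fun B hB => ?_
      rw [← Finset.card_filter, ← h.card_block B hB, ← h.card_points, ← Finset.card_compl,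
        ← Finset.card_powersetCard]
      congr 1
      ext U
      simp only [Finset.mem_powersetCard, Finset.mem_filter, Finset.subset_univ, true_and,
        Finset.subset_compl_iff_disjoint_right]
      tauto
    rw [Finset.sum_congr rfl (g := fun _ => (D.filter (fun B => Disjoint T B)).card),
      Finset.sum_const, Finset.card_powersetCard, Finset.card_univ, h.card_points,
      smul_eq_mul] at hsum
    · have hb := h.card_filter_subset_mul (T := ∅) (Nat.zero_le _)
      simp only [Finset.empty_subset, Finset.filter_true, Finset.card_empty, Nat.sub_zero] at hb
      have p1 : 0 < v.choose t := Nat.choose_pos (hK.trans hv)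
      have p2 : 0 < K.choose t := Nat.choose_pos hK
      refine Nat.eq_of_mul_eq_mul_left p1 (Nat.eq_of_mul_eq_mul_right p2 ?_)
      rw [hsum, mul_right_comm, hb]
      calc l * v.choose t * (v - K).choose t = v.choose t * (l * (v - K).choose t) := by ring
        _ = v.choose t * l' * K.choose t := by rw [← hl, mul_assoc]
    · intro U hU
      have := hc U (Finset.mem_powersetCard.1 hU).2
      rw [← hc T hT] at this
      exact_mod_cast this

/-- |B ∩ B'| = v - 2K + |Bᶜ ∩ B'ᶜ|, and v is even. -/
theorem IsSelfOrthogonalDesign.complementDesign (hso : IsSelfOrthogonalDesign K D)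
    (hcard : ∀ B ∈ D, B.card = K) (hv : Even (Fintype.card X)) :
    IsSelfOrthogonalDesign (Fintype.card X - K) (complementDesign D) := by
  intro B hB B' hB' hne
  rw [mem_complementDesign] at hB hB'
  have h1 := hso _ hB _ hB' (fun e => hne (compl_injective e))
  have c1 := hcard _ hB
  have c2 := hcard _ hB'
  have hu := Finset.card_union_add_card_inter Bᶜ B'ᶜ
  rw [← Finset.compl_inter] at hu
  have hc := Finset.card_add_card_compl (B ∩ B')
  obtain ⟨w, hw⟩ := hv
  have := Finset.card_le_univ Bᶜ
  unfold Nat.ModEq at *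
  omega

end Counting

/-! ### The all-one vector -/

theorem cast_choose_succ (n i : ℕ) :
    (n.choose (i + 1) : ℚ) = n.choose i * ((n : ℚ) - i) / (i + 1) := by
  rw [eq_div_iff (by positivity)]
  have h := Nat.choose_succ_right_eq n i
  rcases le_or_gt i n with hi | hi
  · rw [← Nat.cast_sub hi]
    exact_mod_cast h
  · simp [Nat.choose_eq_zero_of_lt hi, Nat.choose_eq_zero_of_lt (hi.trans (Nat.lt_succ_self i))]

/-- The expansion of `x (x - 2) (x - 4) (x - 6) (x - 8)`, at `x = 2 u`, in binomial
coefficients. -/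
theorem even_choose_expansion (u : ℕ) :
    105 * ((2 * u).choose 1 : ℤ) - 210 * ((2 * u).choose 2 : ℤ) + 270 * ((2 * u).choose 3 : ℤ)
      - 240 * ((2 * u).choose 4 : ℤ) + 120 * ((2 * u).choose 5 : ℤ) =
      3840 * (u.choose 5 : ℤ) := by
  have : (105 * ((2 * u).choose 1 : ℚ) - 210 * ((2 * u).choose 2 : ℚ)
      + 270 * ((2 * u).choose 3 : ℚ) - 240 * ((2 * u).choose 4 : ℚ)
      + 120 * ((2 * u).choose 5 : ℚ)) = 3840 * (u.choose 5 : ℚ) := by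
    -- Over ℚ both sides become polynomials in `u`; 3840 = 2^5 * 5!.
    simp only [cast_choose_succ _ 4, cast_choose_succ _ 3, cast_choose_succ _ 2,
      cast_choose_succ _ 1, Nat.choose_one_right]
    push_cast
    ring
  exact_mod_cast this

section Code

variable {X : Type*} [DecidableEq X] {D : Finset (Finset X)}

theorem row_mem_designCode {B : Finset X} (hB : B ∈ D) :
    (fun x => if x ∈ B then 1 else 0 : X → ZMod 2) ∈ designCode D :=
  Submodule.subset_span ⟨⟨B, hB⟩, rfl⟩

variable [Fintype X]

/-- A set of points that meets every block of a `5`-design in an even number of points has an even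
number of elements, unless the numbers of blocks through `1, …, 5` points are too divisible
by two. -/
theorem IsDesign.even_card_of_even_inter {v K l a : ℕ} (h : IsDesign 5 v K l D) (hK : 5 ≤ K)
    (ha : a < 8) (hdvd : ∀ i ∈ Finset.Icc 1 5, 2 ^ a ∣ replication 5 v K l i)
    (hnot : ¬ 2 ^ (a + 1) ∣ replication 5 v K l 1) {S : Finset X}
    (hS : ∀ B ∈ D, Even (S ∩ B).card) : Even S.card := by
  by_contra hodd
  rw [Nat.not_even_iff_odd] at hodd
  have hsum : (3840 : ℤ) ∣ 105 * (S.card.choose 1 * replication 5 v K l 1 : ℤ)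
      - 210 * (S.card.choose 2 * replication 5 v K l 2 : ℤ)
      + 270 * (S.card.choose 3 * replication 5 v K l 3 : ℤ)
      - 240 * (S.card.choose 4 * replication 5 v K l 4 : ℤ)
      + 120 * (S.card.choose 5 * replication 5 v K l 5 : ℤ) := by
    have e (i : ℕ) (hi : i ≤ 5) : (S.card.choose i * replication 5 v K l i : ℤ) =
        ∑ B ∈ D, ((S ∩ B).card.choose i : ℤ) := by
      exact_mod_cast (h.sum_choose hK S hi).symm
    rw [e 1 (by omega), e 2 (by omega), e 3 (by omega), e 4 (by omega), e 5 (by omega)]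
    simp only [Finset.mul_sum]
    rw [← Finset.sum_sub_distrib, ← Finset.sum_add_distrib, ← Finset.sum_sub_distrib,
      ← Finset.sum_add_distrib]
    refine Finset.dvd_sum fun B hB => ?_
    obtain ⟨u, hu⟩ := (hS B hB).two_dvd
    rw [hu, even_choose_expansion]
    exact dvd_mul_right _ _
  obtain ⟨q1, h1⟩ := hdvd 1 (by simp)
  obtain ⟨q2, h2⟩ := hdvd 2 (by simp)
  obtain ⟨q3, h3⟩ := hdvd 3 (by simp)
  obtain ⟨q4, h4⟩ := hdvd 4 (by simp)
  obtain ⟨q5, h5⟩ := hdvd 5 (by simp)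
  have hq : Odd q1 := by
    rw [← Nat.not_even_iff_odd, even_iff_two_dvd]
    rintro ⟨w, rfl⟩
    exact hnot ⟨w, by rw [h1]; ring⟩
  have h2a : (2 : ℤ) ^ (a + 1) ∣ 3840 :=
    (pow_dvd_pow 2 (show a + 1 ≤ 8 by omega)).trans (by norm_num)
  have hd := h2a.trans hsum
  rw [h1, h2, h3, h4, h5, Nat.choose_one_right] at hd
  push_cast at hd
  obtain ⟨z, hz⟩ := hd
  have hz' : (105 * (S.card * q1) - 210 * (S.card.choose 2 * q2) + 270 * (S.card.choose 3 * q3)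
      - 240 * (S.card.choose 4 * q4) + 120 * (S.card.choose 5 * q5) : ℤ) = 2 * z := by
    have hp : (2 : ℤ) ^ a ≠ 0 := by positivity
    refine mul_left_cancel₀ hp ?_
    rw [pow_succ] at hz
    linear_combination hz
  obtain ⟨w, hw⟩ := hodd.mul hq
  have hw' : (S.card * q1 : ℤ) = 2 * w + 1 := by exact_mod_cast hw
  -- After division by 2^a, every term except 105 * |S| * q1 is even, and that one is odd.
  omega

/-- The all-one vector lies in the code of `D` if every set that meets all blocks evenly is
even. -/
theorem one_mem_designCode
    (h : ∀ S : Finset X, (∀ B ∈ D, Even (S ∩ B).card) → Even S.card) :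
    (1 : X → ZMod 2) ∈ designCode D := by
  by_contra hne
  -- A functional killing the code but not 1 is the dot product with the indicator of a set `S`; its
  -- value at 1 is |S| mod 2.
  obtain ⟨f, hf, hker⟩ := Submodule.exists_le_ker_of_notMem hne
  set S : Finset X := Finset.univ.filter (fun x => f (Pi.single x 1) = 1) with hSdef
  have hz (z : ZMod 2) : z = if z = 1 then 1 else 0 := by
    revert z; decide
  have hfS (B : Finset X) : f (fun x => if x ∈ B then 1 else 0) = ((S ∩ B).card : ZMod 2) := by
    have hB : (fun x => if x ∈ B then 1 else 0 : X → ZMod 2) = ∑ x ∈ B, Pi.single x 1 := by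
      ext y
      simp [Finset.sum_apply, Pi.single_apply]
    rw [hB, map_sum, Finset.sum_congr rfl fun x _ => hz (f (Pi.single x 1)), Finset.sum_boole]
    congr 2
    ext x
    simp [hSdef, and_comm]
  have heven := h S fun B hB => by
    rw [← ZMod.natCast_eq_zero_iff_even, ← hfS]
    exact LinearMap.mem_ker.1 (hker (row_mem_designCode hB))
  apply hf
  have := hfS Finset.univ
  rw [Finset.inter_univ, (ZMod.natCast_eq_zero_iff_even).2 heven] at this
  simpa [Pi.one_def] using this

theorem designCode_complementDesign_le (h : (1 : X → ZMod 2) ∈ designCode D) :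
    designCode (complementDesign D) ≤ designCode D := by
  refine Submodule.span_le.2 ?_
  rintro _ ⟨⟨B, hB⟩, rfl⟩
  have := Submodule.sub_mem _ h (row_mem_designCode (mem_complementDesign.1 hB))
  have e : (incidenceMatrix (complementDesign D)).row ⟨B, hB⟩ =
      1 - fun x => if x ∈ Bᶜ then 1 else 0 := by
    ext x
    by_cases hx : x ∈ B <;> simp [incidenceMatrix, Matrix.row, hx]
  rwa [SetLike.mem_coe, e]

end Code

/-! ### Numerical facts on the extremal parameters -/

set_option maxRecDepth 100000 in
-- Reflects the palindromic symmetry of the enumerator. The range m + 1, ..., 5m - 1 is stable under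
-- k ↦ 6m - k, so it covers a design and its complement alike.
theorem designLambda_complement : ∀ m ∈ List.range' 1 6, ∀ k ∈ List.range' (m + 1) (4 * m - 1),
    designLambda m (6 * m - k) * (4 * k).choose 5 =
      designLambda m k * (24 * m - 4 * k).choose 5 := by
  decide +kernel

set_option maxRecDepth 100000 in
-- Here `a` is the 2-adic valuation of λ_1; the bound 8 is the valuation of 3840.
theorem replication_two_adic : ∀ m ∈ List.range' 1 6, ∀ k ∈ List.range' (m + 1) (4 * m - 1),
    ∃ a ∈ List.range 8,
      (∀ i ∈ Finset.Icc 1 5, 2 ^ a ∣ replication 5 (24 * m) (4 * k) (designLambda m k) i) ∧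
      ¬ 2 ^ (a + 1) ∣ replication 5 (24 * m) (4 * k) (designLambda m k) 1 := by
  decide +kernel

/-! ### Designs with extremal parameters -/

section Extremal

variable {X : Type*} [Fintype X] [DecidableEq X] {D : Finset (Finset X)} {m k : ℕ}

theorem IsExtremalTypeDesign.complementDesign (hm : m ∈ Finset.Icc 1 6)
    (hk : k ∈ Finset.Icc (m + 1) (5 * m - 1)) (h : IsExtremalTypeDesign m k D) :
    IsExtremalTypeDesign m (6 * m - k) (complementDesign D) := by
  rw [Finset.mem_Icc] at hm hk
  have e : 4 * (6 * m - k) = 24 * m - 4 * k := by omega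
  refine ⟨?_, ?_⟩
  · rw [e]
    exact h.1.complementDesign (by omega) (by omega)
      (designLambda_complement m (List.mem_range'_1.2 (by omega)) k
        (List.mem_range'_1.2 (by omega)))
  · rw [e, ← h.1.card_points]
    exact h.2.complementDesign h.1.card_block (h.1.card_points ▸ ⟨12 * m, by omega⟩)

theorem IsExtremalTypeDesign.one_mem_designCode (hm : m ∈ Finset.Icc 1 6)
    (hk : k ∈ Finset.Icc (m + 1) (5 * m - 1)) (h : IsExtremalTypeDesign m k D) :
    (1 : X → ZMod 2) ∈ designCode D := by
  rw [Finset.mem_Icc] at hm hk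
  obtain ⟨a, ha, hd, hn⟩ := replication_two_adic m (List.mem_range'_1.2 (by omega)) k
    (List.mem_range'_1.2 (by omega))
  exact _root_.one_mem_designCode fun S hS =>
    h.1.even_card_of_even_inter (by omega) (List.mem_range.1 ha) hd hn hS

end Extremal

theorem proposition3p4 (m k : ℕ) (hm : m ∈ Finset.Icc 1 6)
    (hk : k ∈ Finset.Icc (m + 1) (3 * m - 1))
    {X : Type*} [Fintype X] [DecidableEq X] (D : Finset (Finset X)) :
    (IsExtremalTypeDesign m k D ↔ IsExtremalTypeDesign m (6 * m - k) (complementDesign D)) ∧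
    (IsExtremalTypeDesign m k D → designCode D = designCode (complementDesign D)) := by
  have hk1 : k ∈ Finset.Icc (m + 1) (5 * m - 1) := by
    rw [Finset.mem_Icc] at hk ⊢
    omega
  have hk2 : 6 * m - k ∈ Finset.Icc (m + 1) (5 * m - 1) := by
    rw [Finset.mem_Icc] at hk ⊢
    omega
  refine ⟨⟨fun h => h.complementDesign hm hk1, fun h => ?_⟩, fun h => le_antisymm ?_ ?_⟩
  · have h' := h.complementDesign hm hk2
    rw [Finset.mem_Icc] at hk1
    rwa [complementDesign_complementDesign, Nat.sub_sub_self (by omega)] at h'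
  -- The inclusion proved for complements is applied to the complement itself.
  · have h1 := (h.complementDesign hm hk1).one_mem_designCode hm hk2
    simpa only [complementDesign_complementDesign] using designCode_complementDesign_le h1
  · exact designCode_complementDesign_le (h.one_mem_designCode hm hk1)
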